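/- Let $n\ge 0$ be an integer and $A\in\mathbb{R}^{n\times n}$. Write $I_n$ for the identity matrix, $\operatorname{diag}(s)$ for the diagonal matrix with diagonal entries $s_1,\dots,s_n$, and understand absolute values and inequalities of vectors and matrices entrywise. The absolute value equation (AVE) with right-hand side $b\in\mathbb{R}^n$ is the system $Ax-|x|=b$ in the unknown $x\in\mathbb{R}^n$. The interval matrix $[A-I_n,A+I_n]$ is the set of all $M\in\mathbb{R}^{n\times n}$ with $A-I_n\le M\le A+I_n$; it is called regular if it contains only nonsingular matrices. The following conditions are equivalent: (i) the AVE has a unique solution for each $b\in\mathbb{R}^n$; (ii) $[A-I_n,A+I_n]$ is regular; (iii) the system $|Ax|\le|x|$ has only the trivial solution $x=0$; (iv) for each $s\in\{\pm1\}^n$, the linear system $(A-\operatorname{diag}(s))x^1-(A+\operatorname{diag}(s))x^2=s$, $x^1,x^2\ge0$, is solvable; (v) $\det(A+\operatorname{diag}(s))$ is positive for all $s\in\{\pm1\}^n$, or negative for all $s\in\{\pm1\}^n$; (vi) for each $i\in\{1,\dots,n\}$ and each $z^{(i)}\in\mathbb{R}^n$ with $z^{(i)}_i\in[-1,1]$ and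 $|z^{(i)}_j|=1$ for all $j\ne i$, the matrix $A+\operatorname{diag}(z^{(i)})$ is nonsingular; (vii) for each $s\in\{\pm1\}^n$ and each real eigenvalue $\lambda$ of $\operatorname{diag}(s)A$ we have $|\lambda|>1$. -/

import Mathlib

open scoped Matrix

/-- The interval matrix `[L, U]`: all real matrices lying entrywise between `L` and `U`. -/
def intervalMatrix {n : ℕ} (L U : Matrix (Fin n) (Fin n) ℝ) : Set (Matrix (Fin n) (Fin n) ℝ) :=
  {M | ∀ i j, L i j ≤ M i j ∧ M i j ≤ U i j}

/-- A set of square matrices (in particular an interval matrix) is regular if it contains only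
nonsingular matrices. -/
def RegularMatrixSet {n : ℕ} (S : Set (Matrix (Fin n) (Fin n) ℝ)) : Prop :=
  ∀ M ∈ S, IsUnit M

/-- The set of sign vectors `{±1}ⁿ`. -/
def signVectors (n : ℕ) : Set (Fin n → ℝ) :=
  {s | ∀ i, s i = 1 ∨ s i = -1}

/-- The solution set of the absolute value equation `A x - |x| = b`, where `|x|` is the entrywise
absolute value. -/
def aveSolutionSet {n : ℕ} (A : Matrix (Fin n) (Fin n) ℝ) (b : Fin n → ℝ) : Set (Fin n → ℝ) :=
  {x | A *ᵥ x - |x| = b}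

/-! Everything passes through regularity, which says that `A + diag z` is nonsingular for every `|z|
≤ 1`. Since `|a| ≤ |b|` means `a = diag z * b` for such a `z`, regularity is (iii), and `A x - t|x|`
with `0 ≤ t ≤ 1` expands distances by a factor `c > 0` that compactness makes uniform
(`mul_norm_sub_le_norm_ave_sub`). This gives uniqueness in (i), and existence by continuation from
`t = 0` to `t = 1` in finitely many contraction steps. Conversely, a nonzero `x` violating (iii)
splits as the difference of two solutions of one AVE. For (iv), the AVE is solved for `diag s * A`;
the converse pairs the system with a left null vector. Conditions (v)-(vii) rest on `det (A + diag
z)` being affine in each `z i`: its sign on the cube is controlled by the vertices, which are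
compared along edges or along segments from the centre. -/

/-! ### Regularity and domination -/

/-- Entrywise domination of reals is multiplication by a factor in `[-1, 1]`. -/
lemma exists_abs_le_one_mul_eq {a b : ℝ} (h : |a| ≤ |b|) : ∃ z : ℝ, |z| ≤ 1 ∧ z * b = a := by
  rcases eq_or_ne b 0 with rfl | hb
  · exact ⟨0, by simp, by simpa using (by simpa using h : a = 0).symm⟩
  · exact ⟨a / b, by rw [abs_div]; exact div_le_one_of_le₀ h (abs_nonneg b), by field_simp⟩

lemma exists_diagonal_mulVec_eq {n : ℕ} {a b : Fin n → ℝ} (h : |a| ≤ |b|) :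
    ∃ z : Fin n → ℝ, (∀ i, |z i| ≤ 1) ∧ Matrix.diagonal z *ᵥ b = a := by
  choose z hz hzb using fun i => exists_abs_le_one_mul_eq (h i)
  exact ⟨z, hz, funext fun i => by rw [Matrix.mulVec_diagonal, hzb]⟩

/-- With `u` and `v` of opposite signs, `|u| - |v|` is `u + v` or `-(u + v)`, so a linear system
determines them. -/
lemma exists_sub_eq_and_abs_sub_abs_eq {x t : ℝ} (h : |t| ≤ |x|) :
    ∃ u v : ℝ, u - v = x ∧ |u| - |v| = t := by
  obtain ⟨h1, h2⟩ := abs_le.mp h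
  rcases le_total 0 x with hx | hx
  · rw [abs_of_nonneg hx] at h1 h2
    refine ⟨(x + t) / 2, (t - x) / 2, by ring, ?_⟩
    rw [abs_of_nonneg (by linarith), abs_of_nonpos (by linarith)]
    ring
  · rw [abs_of_nonpos hx] at h1 h2
    refine ⟨(x - t) / 2, (-x - t) / 2, by ring, ?_⟩
    rw [abs_of_nonpos (by linarith), abs_of_nonneg (by linarith)]
    ring

lemma exists_mulVec_eq_zero_of_not_isUnit {n : ℕ} {M : Matrix (Fin n) (Fin n) ℝ}
    (h : ¬ IsUnit M) : ∃ x : Fin n → ℝ, x ≠ 0 ∧ M *ᵥ x = 0 := by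
  rw [Matrix.isUnit_iff_isUnit_det, isUnit_iff_ne_zero, not_not] at h
  exact Matrix.exists_mulVec_eq_zero_iff.mpr h

lemma eq_zero_of_isUnit_of_mulVec_eq_zero {n : ℕ} {M : Matrix (Fin n) (Fin n) ℝ}
    (h : IsUnit M) {x : Fin n → ℝ} (hx : M *ᵥ x = 0) : x = 0 :=
  Matrix.mulVec_injective_of_isUnit h (by rw [hx, Matrix.mulVec_zero])

lemma regularMatrixSet_iff_forall_diagonal {n : ℕ} (A : Matrix (Fin n) (Fin n) ℝ) :
    RegularMatrixSet (intervalMatrix (A - 1) (A + 1)) ↔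
      ∀ z : Fin n → ℝ, (∀ i, |z i| ≤ 1) → IsUnit (A + Matrix.diagonal z) := by
  constructor
  · intro h z hz
    refine h _ fun i j => ?_
    have := abs_le.mp (hz i)
    rcases eq_or_ne i j with rfl | hij
    · simp only [Matrix.sub_apply, Matrix.add_apply, Matrix.one_apply_eq, Matrix.diagonal_apply_eq]
      constructor <;> linarith
    · simp [hij]
  · intro h M hM
    have hz : A + Matrix.diagonal (fun i => M i i - A i i) = M := by
      ext i j
      have := hM i j
      rcases eq_or_ne i j with rfl | hij
      · simp
      · simp only [Matrix.sub_apply, Matrix.add_apply, Matrix.one_apply_ne hij, sub_zero,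
          add_zero] at this
        simp [hij, le_antisymm this.1 this.2]
    rw [← hz]
    refine h _ fun i => ?_
    have := hM i i
    simp only [Matrix.sub_apply, Matrix.add_apply, Matrix.one_apply_eq] at this
    rw [abs_le]
    constructor <;> linarith

lemma regularMatrixSet_iff_abs_mulVec_le {n : ℕ} (A : Matrix (Fin n) (Fin n) ℝ) :
    RegularMatrixSet (intervalMatrix (A - 1) (A + 1)) ↔
      ∀ x : Fin n → ℝ, |A *ᵥ x| ≤ |x| → x = 0 := by
  rw [regularMatrixSet_iff_forall_diagonal]
  constructor
  · intro h x hx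
    obtain ⟨z, hz, hzx⟩ := exists_diagonal_mulVec_eq
      (show |-(A *ᵥ x)| ≤ |x| by rwa [abs_neg])
    exact eq_zero_of_isUnit_of_mulVec_eq_zero (h z hz)
      (by rw [Matrix.add_mulVec, hzx, add_neg_cancel])
  · intro h z hz
    by_contra hu
    obtain ⟨x, hx0, hx⟩ := exists_mulVec_eq_zero_of_not_isUnit hu
    refine hx0 (h x ?_)
    rw [Matrix.add_mulVec] at hx
    rw [eq_neg_of_add_eq_zero_left hx, abs_neg]
    intro i
    rw [Pi.abs_apply, Pi.abs_apply, Matrix.mulVec_diagonal, abs_mul]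
    exact mul_le_of_le_one_left (abs_nonneg _) (hz i)

lemma abs_mulVec_diagonal_of_mem_signVectors {n : ℕ} {s : Fin n → ℝ} (hs : s ∈ signVectors n)
    (x : Fin n → ℝ) : |Matrix.diagonal s *ᵥ x| = |x| := by
  ext i
  rw [Pi.abs_apply, Pi.abs_apply, Matrix.mulVec_diagonal, abs_mul]
  rcases hs i with h | h <;> simp [h]

/-! ### Unique solvability of the absolute value equation -/

/-- A regular interval matrix of unit radius is uniformly bounded below. -/
lemma exists_pos_mul_norm_le_norm_mulVec {n : ℕ} {A : Matrix (Fin n) (Fin n) ℝ}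
    (h : ∀ z : Fin n → ℝ, (∀ i, |z i| ≤ 1) → IsUnit (A + Matrix.diagonal z)) :
    ∃ c : ℝ, 0 < c ∧ ∀ z : Fin n → ℝ, (∀ i, |z i| ≤ 1) →
      ∀ x : Fin n → ℝ, c * ‖x‖ ≤ ‖(A + Matrix.diagonal z) *ᵥ x‖ := by
  set K : Set ((Fin n → ℝ) × (Fin n → ℝ)) := Metric.closedBall 0 1 ×ˢ Metric.sphere 0 1
  have hK : IsCompact K := (isCompact_closedBall _ _).prod (isCompact_sphere _ _)
  have hf : Continuous fun p : (Fin n → ℝ) × (Fin n → ℝ) =>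
      ‖(A + Matrix.diagonal p.1) *ᵥ p.2‖ := by fun_prop
  have hpos : ∀ p ∈ K, 0 < ‖(A + Matrix.diagonal p.1) *ᵥ p.2‖ := by
    rintro ⟨z, x⟩ ⟨hz, hx⟩
    rw [norm_pos_iff]
    intro h0
    have hz' : ∀ i, |z i| ≤ 1 := by
      have : ‖z‖ ≤ 1 := by simpa using hz
      exact (pi_norm_le_iff_of_nonneg zero_le_one).mp this
    have hx0 : x = 0 := eq_zero_of_isUnit_of_mulVec_eq_zero (h z hz') h0
    simp [hx0] at hx
  obtain ⟨c, hc, hcK⟩ : ∃ c : ℝ, 0 < c ∧ ∀ p ∈ K, c ≤ ‖(A + Matrix.diagonal p.1) *ᵥ p.2‖ := by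
    -- The unit sphere, hence `K`, is empty when `n = 0`.
    rcases K.eq_empty_or_nonempty with hE | hE
    · exact ⟨1, one_pos, by simp [hE]⟩
    · obtain ⟨p, hp, hmin⟩ := hK.exists_isMinOn hE hf.continuousOn
      exact ⟨_, hpos p hp, fun q hq => hmin hq⟩
  refine ⟨c, hc, fun z hz x => ?_⟩
  rcases eq_or_ne x 0 with rfl | hx
  · simp
  have hx' : 0 < ‖x‖ := norm_pos_iff.mpr hx
  have hz' : z ∈ Metric.closedBall (0 : Fin n → ℝ) 1 := by
    rw [mem_closedBall_zero_iff]
    exact (pi_norm_le_iff_of_nonneg zero_le_one).mpr hz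
  have := hcK (z, ‖x‖⁻¹ • x) ⟨hz', by simp [norm_smul, hx'.ne']⟩
  rw [Matrix.mulVec_smul, norm_smul, norm_inv, norm_norm] at this
  rwa [le_inv_mul_iff₀ hx', mul_comm] at this

lemma norm_abs_sub_abs_le {n : ℕ} (x y : Fin n → ℝ) : ‖|x| - |y|‖ ≤ ‖x - y‖ := by
  refine (pi_norm_le_iff_of_nonneg (norm_nonneg _)).mpr fun i => ?_
  exact (abs_abs_sub_abs_le_abs_sub (x i) (y i)).trans (norm_le_pi_norm (x - y) i)

/-- The difference of the two values is `(A + diag z) (x - y)` for a suitable `|z| ≤ 1`. The bound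
does not depend on `t`. -/
lemma mul_norm_sub_le_norm_ave_sub {n : ℕ} {A : Matrix (Fin n) (Fin n) ℝ} {c t : ℝ}
    (hc : ∀ z : Fin n → ℝ, (∀ i, |z i| ≤ 1) →
      ∀ x : Fin n → ℝ, c * ‖x‖ ≤ ‖(A + Matrix.diagonal z) *ᵥ x‖)
    (ht0 : 0 ≤ t) (ht1 : t ≤ 1) (x y : Fin n → ℝ) :
    c * ‖x - y‖ ≤ ‖(A *ᵥ x - t • |x|) - (A *ᵥ y - t • |y|)‖ := by
  have hle : |-(t • (|x| - |y|))| ≤ |x - y| := by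
    intro i
    simp only [Pi.abs_apply, Pi.neg_apply, Pi.smul_apply, Pi.sub_apply, smul_eq_mul, abs_neg,
      abs_mul, abs_of_nonneg ht0]
    exact (mul_le_of_le_one_left (abs_nonneg _) ht1).trans (abs_abs_sub_abs_le_abs_sub _ _)
  obtain ⟨z, hz, hzx⟩ := exists_diagonal_mulVec_eq hle
  refine (hc z hz (x - y)).trans (le_of_eq ?_)
  rw [Matrix.add_mulVec, hzx, Matrix.mulVec_sub, smul_sub]
  congr 1
  abel

/-- One step of the continuation in `t` for the equation `A x - t |x| = b`. -/
lemma ave_solvable_add {n : ℕ} {A : Matrix (Fin n) (Fin n) ℝ} {c t δ : ℝ} (hc0 : 0 < c)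
    (hc : ∀ z : Fin n → ℝ, (∀ i, |z i| ≤ 1) →
      ∀ x : Fin n → ℝ, c * ‖x‖ ≤ ‖(A + Matrix.diagonal z) *ᵥ x‖)
    (ht0 : 0 ≤ t) (ht1 : t ≤ 1) (hδ0 : 0 ≤ δ) (hδ : δ < c)
    (h : ∀ b : Fin n → ℝ, ∃ x : Fin n → ℝ, A *ᵥ x - t • |x| = b) (b : Fin n → ℝ) :
    ∃ x : Fin n → ℝ, A *ᵥ x - (t + δ) • |x| = b := by
  choose g hg using h
  -- The inverse `g` of `x ↦ A x - t|x|` is `1/c`-Lipschitz, and the new equation says that `x` is a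
  -- fixed point of `x ↦ g (b + δ|x|)`.
  have hT : ContractingWith (NNReal.mk (δ / c) (by positivity)) fun x : Fin n → ℝ => g (b + δ • |x|) := by
    refine ⟨?_, LipschitzWith.of_dist_le_mul fun x y => ?_⟩
    · rw [← NNReal.coe_lt_coe]
      exact (div_lt_one hc0).mpr hδ
    · have h1 := mul_norm_sub_le_norm_ave_sub hc ht0 ht1 (g (b + δ • |x|)) (g (b + δ • |y|))
      rw [hg, hg, add_sub_add_left_eq_sub, ← smul_sub, norm_smul, Real.norm_of_nonneg hδ0] at h1
      rw [dist_eq_norm, dist_eq_norm, NNReal.coe_mk, div_mul_eq_mul_div, le_div_iff₀' hc0]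
      exact h1.trans (mul_le_mul_of_nonneg_left (norm_abs_sub_abs_le x y) hδ0)
  have hfix : g (b + δ • |hT.fixedPoint|) = hT.fixedPoint := hT.fixedPoint_isFixedPt
  refine ⟨hT.fixedPoint, ?_⟩
  have := hg (b + δ • |hT.fixedPoint|)
  rw [hfix] at this
  rw [add_smul, ← sub_sub, this, add_sub_cancel_right]

lemma existsUnique_mem_aveSolutionSet {n : ℕ} {A : Matrix (Fin n) (Fin n) ℝ}
    (h : RegularMatrixSet (intervalMatrix (A - 1) (A + 1))) (b : Fin n → ℝ) :
    ∃! x : Fin n → ℝ, x ∈ aveSolutionSet A b := by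
  rw [regularMatrixSet_iff_forall_diagonal] at h
  obtain ⟨c, hc0, hc⟩ := exists_pos_mul_norm_le_norm_mulVec h
  -- A step `1/(N+1) < c` is admissible at every `t`, so `N + 1` steps reach `t = 1`.
  obtain ⟨N, hN⟩ := exists_nat_one_div_lt hc0
  have hN0 : (0 : ℝ) < N + 1 := by positivity
  have hstep : ∀ k : ℕ, k ≤ N + 1 → ∀ b : Fin n → ℝ, ∃ x : Fin n → ℝ,
      A *ᵥ x - ((k : ℝ) * (1 / (N + 1))) • |x| = b := by
    intro k
    induction k with
    | zero =>
      intro _ b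
      have hA : IsUnit A := by simpa using h 0 (by simp)
      obtain ⟨x, hx⟩ := Matrix.mulVec_surjective_iff_isUnit.mpr hA b
      exact ⟨x, by simpa using hx⟩
    | succ k ih =>
      intro hk b
      have hk' : (k : ℝ) ≤ N + 1 := by exact_mod_cast (Nat.le_succ k).trans hk
      have := ave_solvable_add (δ := 1 / (N + 1)) hc0 hc (by positivity)
        (by rw [mul_one_div]; exact div_le_one_of_le₀ hk' hN0.le) (by positivity) hN
        (ih ((Nat.le_succ k).trans hk)) b
      simpa [add_mul] using this
  obtain ⟨x, hx⟩ := hstep (N + 1) le_rfl b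
  have h1 : ((N + 1 : ℕ) : ℝ) * (1 / (N + 1)) = 1 := by
    push_cast
    field_simp
  rw [h1, one_smul] at hx
  refine ⟨x, hx, fun y hy => ?_⟩
  have hy' : A *ᵥ y - |y| = b := hy
  have := mul_norm_sub_le_norm_ave_sub hc zero_le_one le_rfl y x
  rw [one_smul, one_smul, hx, hy', sub_self, norm_zero] at this
  have h0 : ‖y - x‖ ≤ 0 := by nlinarith [norm_nonneg (y - x)]
  exact sub_eq_zero.mp (norm_le_zero_iff.mp h0)

lemma eq_zero_of_abs_mulVec_le_of_existsUnique {n : ℕ} {A : Matrix (Fin n) (Fin n) ℝ}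
    (h : ∀ b : Fin n → ℝ, ∃! x : Fin n → ℝ, x ∈ aveSolutionSet A b) {x : Fin n → ℝ}
    (hx : |A *ᵥ x| ≤ |x|) : x = 0 := by
  choose u v huv huv' using fun i => exists_sub_eq_and_abs_sub_abs_eq (hx i)
  have hx' : u - v = x := funext huv
  have hA : A *ᵥ u - A *ᵥ v = |u| - |v| := by
    rw [← Matrix.mulVec_sub, hx']
    exact (funext huv').symm
  have hu : u ∈ aveSolutionSet A (A *ᵥ v - |v|) := by
    change A *ᵥ u - |u| = A *ᵥ v - |v|
    rw [sub_eq_sub_iff_sub_eq_sub, hA]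
  have hv : v ∈ aveSolutionSet A (A *ᵥ v - |v|) := rfl
  rw [← hx', (h _).unique hu hv, sub_self]

/-! ### Nonnegative solutions of the signed linear systems -/

lemma regularMatrixSet_diagonal_mul {n : ℕ} {A : Matrix (Fin n) (Fin n) ℝ}
    (h : RegularMatrixSet (intervalMatrix (A - 1) (A + 1))) {s : Fin n → ℝ}
    (hs : s ∈ signVectors n) :
    RegularMatrixSet (intervalMatrix (Matrix.diagonal s * A - 1) (Matrix.diagonal s * A + 1)) := by
  rw [regularMatrixSet_iff_abs_mulVec_le] at h ⊢
  intro x hx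
  rw [← Matrix.mulVec_mulVec, abs_mulVec_diagonal_of_mem_signVectors hs] at hx
  exact h x hx

lemma mul_self_eq_one_of_mem_signVectors {n : ℕ} {s : Fin n → ℝ} (hs : s ∈ signVectors n)
    (i : Fin n) : s i * s i = 1 := by
  rcases hs i with h | h <;> simp [h]

lemma sub_mulVec_sub_add_mulVec {n : ℕ} (A : Matrix (Fin n) (Fin n) ℝ) (s x₁ x₂ : Fin n → ℝ)
    (i : Fin n) : ((A - Matrix.diagonal s) *ᵥ x₁ - (A + Matrix.diagonal s) *ᵥ x₂) i =
      (A *ᵥ (x₁ - x₂)) i - s i * (x₁ i + x₂ i) := by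
  rw [Matrix.sub_mulVec, Matrix.add_mulVec, Matrix.mulVec_sub]
  simp only [Pi.sub_apply, Pi.add_apply, Matrix.mulVec_diagonal]
  ring

/-- The positive and negative parts of the solution of `diag s * A x - |x| = 1` work, after
multiplication by `diag s`. -/
lemma exists_nonneg_solution_of_regularMatrixSet {n : ℕ} {A : Matrix (Fin n) (Fin n) ℝ}
    (h : RegularMatrixSet (intervalMatrix (A - 1) (A + 1))) {s : Fin n → ℝ}
    (hs : s ∈ signVectors n) : ∃ x₁ x₂ : Fin n → ℝ, 0 ≤ x₁ ∧ 0 ≤ x₂ ∧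
      (A - Matrix.diagonal s) *ᵥ x₁ - (A + Matrix.diagonal s) *ᵥ x₂ = s := by
  obtain ⟨x, hx, -⟩ := existsUnique_mem_aveSolutionSet (regularMatrixSet_diagonal_mul h hs) 1
  refine ⟨x⁺, x⁻, posPart_nonneg x, negPart_nonneg x, funext fun i => ?_⟩
  rw [sub_mulVec_sub_add_mulVec, posPart_sub_negPart, ← Pi.add_apply, posPart_add_negPart,
    Pi.abs_apply]
  have hxi := congrFun (show (Matrix.diagonal s * A) *ᵥ x - |x| = 1 from hx) i
  rw [← Matrix.mulVec_mulVec, Pi.sub_apply, Matrix.mulVec_diagonal, Pi.abs_apply,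
    Pi.one_apply] at hxi
  linear_combination s i * hxi - (A *ᵥ x) i * mul_self_eq_one_of_mem_signVectors hs i

lemma exists_signVector_mul_eq_abs {n : ℕ} (y : Fin n → ℝ) :
    ∃ s ∈ signVectors n, ∀ i, y i * s i = |y i| := by
  refine ⟨fun i => if 0 ≤ y i then 1 else -1, fun i => ?_, fun i => ?_⟩
  · by_cases hi : 0 ≤ y i <;> simp [hi]
  · by_cases hi : 0 ≤ y i
    · simp [hi, abs_of_nonneg]
    · simp [hi, abs_of_neg (not_le.mp hi)]

/-- Let `y` be a left null vector of `A + diag z` and `s` its sign vector. Pairing `y` with `(A +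
diag z) (x₁ - x₂)` gives zero, yet `x₁, x₂ ≥ 0` makes the `i`-th term at least `|y i|`. -/
lemma regularMatrixSet_of_exists_nonneg_solution {n : ℕ} {A : Matrix (Fin n) (Fin n) ℝ}
    (h : ∀ s ∈ signVectors n, ∃ x₁ x₂ : Fin n → ℝ, 0 ≤ x₁ ∧ 0 ≤ x₂ ∧
      (A - Matrix.diagonal s) *ᵥ x₁ - (A + Matrix.diagonal s) *ᵥ x₂ = s) :
    RegularMatrixSet (intervalMatrix (A - 1) (A + 1)) := by
  rw [regularMatrixSet_iff_forall_diagonal]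
  intro z hz
  by_contra hu
  have hdet : (A + Matrix.diagonal z).det = 0 := by
    rwa [Matrix.isUnit_iff_isUnit_det, isUnit_iff_ne_zero, not_not] at hu
  obtain ⟨y, hy0, hy⟩ := Matrix.exists_vecMul_eq_zero_iff.mpr hdet
  obtain ⟨s, hs, hys⟩ := exists_signVector_mul_eq_abs y
  obtain ⟨x₁, x₂, h1, h2, h12⟩ := h s hs
  have hsum : ∑ i, y i * ((A *ᵥ (x₁ - x₂)) i + z i * (x₁ i - x₂ i)) = 0 := by
    have h0 : y ⬝ᵥ ((A + Matrix.diagonal z) *ᵥ (x₁ - x₂)) = 0 := by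
      rw [Matrix.dotProduct_mulVec, hy, zero_dotProduct]
    rw [← h0, dotProduct]
    refine Finset.sum_congr rfl fun i _ => ?_
    rw [Matrix.add_mulVec, Pi.add_apply, Matrix.mulVec_diagonal, Pi.sub_apply]
  have hterm : ∀ i, |y i| ≤ y i * ((A *ᵥ (x₁ - x₂)) i + z i * (x₁ i - x₂ i)) := by
    intro i
    have hi := congrFun h12 i
    rw [sub_mulVec_sub_add_mulVec] at hi
    have hsplit : y i * ((A *ᵥ (x₁ - x₂)) i + z i * (x₁ i - x₂ i)) =
        |y i| + (|y i| * (x₁ i + x₂ i) + y i * (z i * (x₁ i - x₂ i))) := by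
      rw [← hys]
      linear_combination y i * hi
    have hx : |x₁ i - x₂ i| ≤ x₁ i + x₂ i := by
      have := h1 i
      have := h2 i
      simp only [Pi.zero_apply] at *
      rw [abs_le]
      constructor <;> linarith
    have hb : |y i * (z i * (x₁ i - x₂ i))| ≤ |y i| * (x₁ i + x₂ i) := by
      rw [abs_mul, abs_mul]
      exact mul_le_mul_of_nonneg_left
        ((mul_le_of_le_one_left (abs_nonneg _) (hz i)).trans hx) (abs_nonneg _)
    have := (abs_le.mp hb).1
    rw [hsplit]
    linarith
  have habs : ∑ i, |y i| ≤ 0 := hsum ▸ Finset.sum_le_sum fun i _ => hterm i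
  refine hy0 (funext fun i => ?_)
  have := Finset.single_le_sum (f := fun i => |y i|) (fun j _ => abs_nonneg (y j))
    (Finset.mem_univ i)
  exact abs_nonpos_iff.mp (this.trans habs)

/-! ### Determinants on the cube and its edges -/

/-- The determinant of `A + diag z` is affine in each entry of `z`. -/
lemma exists_det_add_diagonal_update_eq {n : ℕ} (A : Matrix (Fin n) (Fin n) ℝ) (z : Fin n → ℝ)
    (i : Fin n) : ∃ p q : ℝ, ∀ t : ℝ,
      (A + Matrix.diagonal (Function.update z i t)).det = p + t * q := by
  refine ⟨((A + Matrix.diagonal z).updateRow i (A i)).det,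
    ((A + Matrix.diagonal z).updateRow i (Pi.single i 1)).det, fun t => ?_⟩
  rw [← Matrix.det_updateRow_smul, ← Matrix.det_updateRow_add]
  congr 1
  ext j k
  rcases eq_or_ne j i with rfl | hj
  · rcases eq_or_ne k j with rfl | hk
    · simp
    · simp [hk, hk.symm]
  · simp [hj, Matrix.diagonal_apply]

/-- Coordinates are released from `±1` one at a time, `S` collecting the released ones; affinity in
the new coordinate preserves the sign. The factor `σ` lets one argument serve both signs. -/
lemma pos_mul_det_of_forall_signVectors {n : ℕ} {A : Matrix (Fin n) (Fin n) ℝ} {σ : ℝ}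
    (h : ∀ s ∈ signVectors n, 0 < σ * (A + Matrix.diagonal s).det) {z : Fin n → ℝ}
    (hz : ∀ i, |z i| ≤ 1) : 0 < σ * (A + Matrix.diagonal z).det := by
  have key : ∀ (S : Finset (Fin n)) (z : Fin n → ℝ), (∀ i, |z i| ≤ 1) →
      (∀ i ∉ S, z i = 1 ∨ z i = -1) → 0 < σ * (A + Matrix.diagonal z).det := by
    intro S
    induction S using Finset.induction_on with
    | empty => exact fun z _ hS => h z fun i => hS i (Finset.notMem_empty i)
    | insert a S _ ih =>
      intro z hz hS
      obtain ⟨p, q, hpq⟩ := exists_det_add_diagonal_update_eq A z a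
      have hv : ∀ t : ℝ, (t = 1 ∨ t = -1) → 0 < σ * (p + t * q) := by
        intro t ht
        rw [← hpq]
        refine ih _ (fun i => ?_) fun i hi => ?_
        · rcases eq_or_ne i a with rfl | hia
          · rcases ht with rfl | rfl <;> simp
          · simpa [hia] using hz i
        · rcases eq_or_ne i a with rfl | hia
          · simpa using ht
          · simpa [hia] using hS i (by simp [hia, hi])
      have h1 := hv 1 (Or.inl rfl)
      have h2 := hv (-1) (Or.inr rfl)
      have h3 := hpq (z a)
      rw [Function.update_eq_self] at h3
      obtain ⟨hl, hr⟩ := abs_le.mp (hz a)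
      rw [h3]
      -- Twice the value is `(1 + z a) f(1) + (1 - z a) f(-1)`; the first weight vanishes at `z a =
      -- -1`.
      rcases hl.eq_or_lt with hl | hl
      · rwa [← hl]
      · nlinarith [mul_pos (by linarith : 0 < 1 + z a) h1,
          mul_nonneg (by linarith : 0 ≤ 1 - z a) h2.le]
  exact key Finset.univ z hz fun i hi => absurd (Finset.mem_univ i) hi

lemma regularMatrixSet_of_det_sign {n : ℕ} {A : Matrix (Fin n) (Fin n) ℝ}
    (h : (∀ s ∈ signVectors n, 0 < (A + Matrix.diagonal s).det) ∨
      ∀ s ∈ signVectors n, (A + Matrix.diagonal s).det < 0) :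
    RegularMatrixSet (intervalMatrix (A - 1) (A + 1)) := by
  rw [regularMatrixSet_iff_forall_diagonal]
  intro z hz
  rw [Matrix.isUnit_iff_isUnit_det, isUnit_iff_ne_zero]
  intro h0
  rcases h with h | h
  · have := pos_mul_det_of_forall_signVectors (σ := 1) (fun s hs => by simpa using h s hs) hz
    simp [h0] at this
  · have := pos_mul_det_of_forall_signVectors (σ := -1) (fun s hs => by simpa using h s hs) hz
    simp [h0] at this

/-- If all the values have the sign of one nonzero number, they are all positive or all
negative. -/
lemma forall_pos_or_forall_neg_of_mul_pos {α : Type*} {S : Set α} {f : α → ℝ} {d : ℝ}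
    (h : ∀ s ∈ S, 0 < d * f s) : (∀ s ∈ S, 0 < f s) ∨ ∀ s ∈ S, f s < 0 := by
  rcases le_or_gt 0 d with hd | hd
  · exact Or.inl fun s hs => pos_of_mul_pos_right (h s hs) hd
  · exact Or.inr fun s hs => neg_of_mul_pos_right (h s hs) hd.le

lemma mul_pos_of_continuous_of_forall_ne_zero {f : ℝ → ℝ} {a b : ℝ} (hab : a ≤ b)
    (hf : Continuous f) (h : ∀ t ∈ Set.Icc a b, f t ≠ 0) : 0 < f a * f b := by
  have ha := h a (Set.left_mem_Icc.mpr hab)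
  have hb := h b (Set.right_mem_Icc.mpr hab)
  rcases ha.lt_or_gt with ha | ha <;> rcases hb.lt_or_gt with hb | hb
  · exact mul_pos_of_neg_of_neg ha hb
  · obtain ⟨t, ht, ht0⟩ := intermediate_value_Icc hab hf.continuousOn ⟨ha.le, hb.le⟩
    exact absurd ht0 (h t ht)
  · obtain ⟨t, ht, ht0⟩ := intermediate_value_Icc' hab hf.continuousOn ⟨hb.le, ha.le⟩
    exact absurd ht0 (h t ht)
  · exact mul_pos ha hb

lemma det_sign_of_isUnit_on_edges {n : ℕ} {A : Matrix (Fin n) (Fin n) ℝ}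
    (h : ∀ (i : Fin n) (z : Fin n → ℝ), z i ∈ Set.Icc (-1 : ℝ) 1 → (∀ j, j ≠ i → |z j| = 1) →
      IsUnit (A + Matrix.diagonal z)) :
    (∀ s ∈ signVectors n, 0 < (A + Matrix.diagonal s).det) ∨
      ∀ s ∈ signVectors n, (A + Matrix.diagonal s).det < 0 := by
  have hedge : ∀ (i : Fin n) (s : Fin n → ℝ), s ∈ signVectors n →
      0 < (A + Matrix.diagonal (Function.update s i (-1))).det *
        (A + Matrix.diagonal (Function.update s i 1)).det := by
    intro i s hs
    refine mul_pos_of_continuous_of_forall_ne_zero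
      (f := fun t => (A + Matrix.diagonal (Function.update s i t)).det) (by norm_num) ?_ ?_
    · obtain ⟨p, q, hpq⟩ := exists_det_add_diagonal_update_eq A s i
      simp only [hpq]
      fun_prop
    · intro t ht
      rw [← isUnit_iff_ne_zero, ← Matrix.isUnit_iff_isUnit_det]
      refine h i _ (by simpa using ht) fun j hj => ?_
      rw [Function.update_of_ne hj]
      rcases hs j with hj | hj <;> simp [hj]
  -- For `n = 0` the hypothesis is vacuous, but the determinant is `1`.
  rcases isEmpty_or_nonempty (Fin n) with hE | ⟨⟨i₀⟩⟩
  · exact Or.inl fun s _ => by simp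
  have hone : (A + Matrix.diagonal (fun _ => (1 : ℝ))).det ≠ 0 := by
    rw [← isUnit_iff_ne_zero, ← Matrix.isUnit_iff_isUnit_det]
    exact h i₀ _ (by simp) (by simp)
  refine forall_pos_or_forall_neg_of_mul_pos (d := (A + Matrix.diagonal (fun _ => (1 : ℝ))).det) ?_
  -- Walk along edges from the all-ones vertex; `S` contains every coordinate where `s` may be `-1`.
  have key : ∀ (S : Finset (Fin n)) (s : Fin n → ℝ), s ∈ signVectors n →
      (∀ i ∉ S, s i = 1) → 0 < (A + Matrix.diagonal (fun _ => (1 : ℝ))).det *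
        (A + Matrix.diagonal s).det := by
    intro S
    induction S using Finset.induction_on with
    | empty =>
      intro s _ hS
      rw [show s = fun _ => (1 : ℝ) from funext fun i => hS i (Finset.notMem_empty i)]
      exact mul_self_pos.mpr hone
    | insert a S _ ih =>
      intro s hs hS
      have h1 := ih (Function.update s a 1)
        (fun i => by
          rcases eq_or_ne i a with rfl | hia
          · simp
          · simpa [hia] using hs i)
        (fun i hi => by
          rcases eq_or_ne i a with rfl | hia
          · simp
          · simpa [hia] using hS i (by simp [hia, hi]))
      rcases hs a with ha | ha
      · rwa [Function.update_eq_self_iff.mpr ha.symm] at h1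
      · have h2 := hedge a s hs
        rw [← ha, Function.update_eq_self] at h2
        refine pos_of_mul_pos_left (b := (A + Matrix.diagonal (Function.update s a 1)).det ^ 2) ?_
          (sq_nonneg _)
        nlinarith [mul_pos h1 h2]
  exact fun s hs => key Finset.univ s hs fun i hi => absurd (Finset.mem_univ i) hi

/-! ### Real eigenvalues -/

/-- As `diag s` squares to `1`, a zero of `det (A + t diag s)` makes `-t` an eigenvalue of `diag s *
A`. None occurs for `t` in `[0, 1]`, so every vertex determinant has the sign of `det A`. -/
lemma det_sign_of_eigenvalues {n : ℕ} {A : Matrix (Fin n) (Fin n) ℝ}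
    (h : ∀ s ∈ signVectors n, ∀ μ : ℝ,
      Module.End.HasEigenvalue (Matrix.toLin' (Matrix.diagonal s * A)) μ → 1 < |μ|) :
    (∀ s ∈ signVectors n, 0 < (A + Matrix.diagonal s).det) ∨
      ∀ s ∈ signVectors n, (A + Matrix.diagonal s).det < 0 := by
  refine forall_pos_or_forall_neg_of_mul_pos (d := A.det) fun s hs => ?_
  have := mul_pos_of_continuous_of_forall_ne_zero
    (f := fun t : ℝ => (A + Matrix.diagonal (t • s)).det) zero_le_one (by fun_prop) ?_
  · simpa using this
  intro t ht h0
  obtain ⟨x, hx0, hx⟩ := Matrix.exists_mulVec_eq_zero_iff.mpr h0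
  have hev : Module.End.HasEigenvalue (Matrix.toLin' (Matrix.diagonal s * A)) (-t) := by
    refine Module.End.hasEigenvalue_of_hasEigenvector (x := x)
      ⟨Module.End.mem_eigenspace_iff.mpr ?_, hx0⟩
    ext i
    have hi := congrFun hx i
    rw [Matrix.add_mulVec, Pi.add_apply, Matrix.mulVec_diagonal, Pi.smul_apply, smul_eq_mul,
      Pi.zero_apply] at hi
    rw [Matrix.toLin'_apply, ← Matrix.mulVec_mulVec, Matrix.mulVec_diagonal, Pi.smul_apply,
      smul_eq_mul]
    linear_combination s i * hi - t * x i * mul_self_eq_one_of_mem_signVectors hs i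
  have := h s hs _ hev
  rw [abs_neg, abs_of_nonneg ht.1] at this
  exact absurd ht.2 (not_le.mpr this)

lemma one_lt_abs_of_hasEigenvalue {n : ℕ} {A : Matrix (Fin n) (Fin n) ℝ}
    (h : RegularMatrixSet (intervalMatrix (A - 1) (A + 1))) {s : Fin n → ℝ}
    (hs : s ∈ signVectors n) {μ : ℝ}
    (hμ : Module.End.HasEigenvalue (Matrix.toLin' (Matrix.diagonal s * A)) μ) : 1 < |μ| := by
  obtain ⟨x, hx⟩ := hμ.exists_hasEigenvector
  by_contra! hle
  refine hx.2 ((regularMatrixSet_iff_abs_mulVec_le _).mp (regularMatrixSet_diagonal_mul h hs) x ?_)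
  rw [← Matrix.toLin'_apply, hx.apply_eq_smul]
  intro i
  rw [Pi.abs_apply, Pi.abs_apply, Pi.smul_apply, smul_eq_mul, abs_mul]
  exact mul_le_of_le_one_left (abs_nonneg _) hle

theorem mainTheorem7 (n : ℕ) (A : Matrix (Fin n) (Fin n) ℝ) :
    List.TFAE [
      ∀ b : Fin n → ℝ, ∃! x : Fin n → ℝ, x ∈ aveSolutionSet A b,
      RegularMatrixSet (intervalMatrix (A - 1) (A + 1)),
      ∀ x : Fin n → ℝ, |A *ᵥ x| ≤ |x| ↔ x = 0,
      ∀ s ∈ signVectors n, ∃ x₁ x₂ : Fin n → ℝ, 0 ≤ x₁ ∧ 0 ≤ x₂ ∧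
        (A - Matrix.diagonal s) *ᵥ x₁ - (A + Matrix.diagonal s) *ᵥ x₂ = s,
      (∀ s ∈ signVectors n, 0 < (A + Matrix.diagonal s).det) ∨
        (∀ s ∈ signVectors n, (A + Matrix.diagonal s).det < 0),
      ∀ (i : Fin n) (z : Fin n → ℝ), z i ∈ Set.Icc (-1 : ℝ) 1 → (∀ j, j ≠ i → |z j| = 1) →
        IsUnit (A + Matrix.diagonal z),
      ∀ s ∈ signVectors n, ∀ μ : ℝ,
        Module.End.HasEigenvalue (Matrix.toLin' (Matrix.diagonal s * A)) μ → 1 < |μ|] := by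
  tfae_have 1 → 3 := fun h x =>
    ⟨eq_zero_of_abs_mulVec_le_of_existsUnique h, by rintro rfl; simp⟩
  tfae_have 3 → 2 := fun h =>
    (regularMatrixSet_iff_abs_mulVec_le A).mpr fun x => (h x).mp
  tfae_have 2 → 1 := existsUnique_mem_aveSolutionSet
  tfae_have 2 → 4 := fun h _ => exists_nonneg_solution_of_regularMatrixSet h
  tfae_have 4 → 2 := regularMatrixSet_of_exists_nonneg_solution
  tfae_have 5 → 2 := regularMatrixSet_of_det_sign
  tfae_have 6 → 5 := det_sign_of_isUnit_on_edges
  tfae_have 7 → 5 := det_sign_of_eigenvalues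
  tfae_have 2 → 7 := fun h _ hs _ => one_lt_abs_of_hasEigenvalue h hs
  tfae_have 2 → 6 := by
    intro h i z hi hz
    refine (regularMatrixSet_iff_forall_diagonal A).mp h z fun j => ?_
    rcases eq_or_ne j i with rfl | hj
    · exact abs_le.mpr hi
    · exact (hz j hj).le
  tfae_finish
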